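/- Let $K$ be a field and let $A=K\langle x_1,\dots,x_n\mid x_jx_i=c_{ij}x_ix_j+d_{ij},\ 1\le i<j\le n\rangle$ be a $G$-algebra, i.e. the $c_{ij}\in K$ are nonzero, the $d_{ij}$ are standard polynomials ($K$-linear combinations of standard monomials $x^\alpha=x_1^{\alpha_1}\cdots x_n^{\alpha_n}$) such that, for some monomial ordering $\succ$ on $\mathbb N^n$ (a total well-ordering compatible with addition), $d_{ij}=0$ or $\epsilon_i+\epsilon_j\succ\exp_\succ(d_{ij})$ for all $i<j$, and for all $i<j<k$ the element $$c_{ik}c_{jk}\, d_{ij}x_k - x_k d_{ij} + c_{jk}\, x_j d_{ik} - c_{ij}\, d_{ik}x_j + d_{jk}x_i - c_{ij}c_{ik}\, x_i d_{jk}$$ of the free algebra reduces to zero with respect to the relations of $A$. Then the standard monomials form a $K$-basis of $A$; the Newton diagram $\mathcal N(f)\subset\mathbb N^n$ of $f\in A$ is the set of exponents that occur in $f$ with nonzero coefficient. Let $\omega\in\mathbb N_{\ge1}^n$, and write $|\alpha|_\omega=\sum_i\omega_i\alpha_i$; suppose that $\omega_i+\omega_j>|\alpha|_\omega$ for all $i<j$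 and all $\alpha\in\mathcal N(d_{ij})$. Put $\deg_\omega(f)=\max\{|\alpha|_\omega:\alpha\in\mathcal N(f)\}$ for $f\neq0$, $F_dA=\{f\in A: f=0\text{ or }\deg_\omega(f)\le d\}$, and let $R=\bigoplus_{d\ge0}(F_dA)\,t^d\subset A[t]$ be the Rees algebra. It has the $K$-basis of standard monomials $\tilde x^\alpha t^k$ ($\alpha\in\mathbb N^n$, $k\in\mathbb N$), where $\tilde x_i=x_it^{\omega_i}$; put $|(\alpha,k)|_{\tilde\omega}=|\alpha|_\omega+k$, and call $F\in R$ $\tilde\omega$-homogeneous if $|\cdot|_{\tilde\omega}$ is constant on the exponents occurring in $F$. For $0\ne f\in A$ let $f^h=ft^{\deg_\omega(f)}\in R$, and $0^h=0$; for $F\in R$ let $F|_{t=1}\in A$ be its dehomogenization. Let $>$ be a monomial ordering on $\mathbb N^n$, and define $>^h$ on $\mathbb N^{n+1}$ by: $(\alpha,d)>^h(\beta,e)$ iff $|(\alpha,d)|_{\tilde\omega}>|(\beta,e)|_{\tilde\omega}$, or $|(\alpha,d)|_{\tilde\omega}=|(\beta,e)|_{\tilde\omega}$ and $\alpha>\beta$.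 For a nonzero left ideal $L$ of $A$ (resp. $R$), a Gröbner basis of $L$ with respect to $>$ (resp. $>^h$) is a finite subset $\mathcal G\subset L\setminus\{0\}$ such that $\{\exp(f): f\in L\setminus\{0\}\}=\bigcup_{g\in\mathcal G}(\exp(g)+\mathbb N^{n})$ (resp. with $\mathbb N^{n+1}$), where $\exp(f)$ is the largest exponent occurring in $f$. **Proposition.** Let $I=\langle f_1,\dots,f_r\rangle\subset A$ be a nonzero left ideal, and let $J=\langle f_1^h,\dots,f_r^h\rangle\subset R$ be the left ideal generated by the homogenizations of the given generators. If $\mathcal G$ is a Gröbner basis of $J$ with respect to $>^h$ which consists of $\tilde\omega$-homogeneous elements, then $\mathcal G|_{t=1}=\{G|_{t=1}: G\in\mathcal G\}$ is a Gröbner basis of $I$ with respect to $>$. -/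

import Mathlib

noncomputable section

open Polynomial

namespace GAlg

/-! ### Exponents, weights, standard monomials -/

/-- Exponents `α ∈ ℕⁿ`. -/
abbrev Expo (n : ℕ) : Type := Fin n →₀ ℕ

/-- The weighted degree `|α|_ω = ω₁ α₁ + ⋯ + ωₙ αₙ`. -/
def wt {n : ℕ} (ω : Fin n → ℕ) (α : Expo n) : ℕ := ∑ i, ω i * α i

/-- The ordered product `x₁^α₁ ⋯ xₙ^αₙ` in a (not necessarily commutative) monoid. -/
def stdMon {M : Type*} [Monoid M] {n : ℕ} (x : Fin n → M) (α : Expo n) : M :=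
  (List.ofFn fun i => x i ^ α i).prod

/-- The free associative algebra `K⟨x₁, …, xₙ⟩`: the monoid algebra of the free monoid. -/
abbrev Free (K : Type*) [Field K] (n : ℕ) : Type _ := MonoidAlgebra K (FreeMonoid (Fin n))

/-- A word, seen as an element of the free associative algebra. -/
def word {K : Type*} [Field K] {n : ℕ} (w : FreeMonoid (Fin n)) : Free K n :=
  MonoidAlgebra.of K (FreeMonoid (Fin n)) w

/-- The variable `xᵢ` of the free associative algebra. -/
def freeVar {K : Type*} [Field K] {n : ℕ} (i : Fin n) : Free K n := word (FreeMonoid.of i)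

/-- The element `∑ c_α x^α` of the free algebra given by the coefficients `c_α` of a standard
polynomial. -/
def stdPoly {K : Type*} [Field K] {n : ℕ} (p : Expo n →₀ K) : Free K n :=
  Finsupp.linearCombination K (fun α : Expo n => (stdMon freeVar α : Free K n)) p

/-! ### Presentations and G-algebras -/

/-- Scalars `c i j` and standard polynomials `d i j`; only the values at `i < j` are used, for the
relations `x_j x_i = c_{ij} x_i x_j + d_{ij}`. -/
structure Presentation (K : Type*) [Field K] (n : ℕ) where
  c : Fin n → Fin n → K
  d : Fin n → Fin n → (Expo n →₀ K)

namespace Presentation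

variable {K : Type*} [Field K] {n : ℕ} (P : Presentation K n)

/-- The defining relations `x_j x_i = c_{ij} x_i x_j + d_{ij}`, `i < j`. -/
inductive Rel : Free K n → Free K n → Prop
  | comm (i j : Fin n) (hij : i < j) :
      Rel (freeVar j * freeVar i) (P.c i j • (freeVar i * freeVar j) + stdPoly (P.d i j))

/-- One reduction step with respect to the relations: a word `u x_j x_i v` (`i < j`) that occurs
in `f` is replaced by `u (c_{ij} x_i x_j + d_{ij}) v`. -/
def Step (f g : Free K n) : Prop :=
  ∃ (i j : Fin n) (u v : FreeMonoid (Fin n)) (a : K), i < j ∧ a ≠ 0 ∧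
    a = f.coeff (u * FreeMonoid.of j * FreeMonoid.of i * v) ∧
    g = f - a • (word u * (freeVar j * freeVar i) * word v)
          + a • (word u * (P.c i j • (freeVar i * freeVar j) + stdPoly (P.d i j)) * word v)

/-- `f` reduces to zero with respect to the relations, by finitely many reduction steps. -/
def ReducesToZero (f : Free K n) : Prop := Relation.ReflTransGen P.Step f 0

/-- The monomial ordering `m` is admissible: `d_{ij} = 0` or `ε_i + ε_j > exp(d_{ij})`, i.e. every
exponent occurring in `d_{ij}` is smaller than `ε_i + ε_j`. -/
def Admissible (m : MonomialOrder (Fin n)) : Prop :=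
  ∀ i j : Fin n, i < j → ∀ α ∈ (P.d i j).support,
    m.toSyn α < m.toSyn (Finsupp.single i 1 + Finsupp.single j 1)

/-- The element attached to `i < j < k` in the non-degeneracy condition. -/
def overlap (i j k : Fin n) : Free K n :=
  (P.c i k * P.c j k) • (stdPoly (P.d i j) * freeVar k) - freeVar k * stdPoly (P.d i j)
    + P.c j k • (freeVar j * stdPoly (P.d i k)) - P.c i j • (stdPoly (P.d i k) * freeVar j)
    + stdPoly (P.d j k) * freeVar i - (P.c i j * P.c i k) • (freeVar i * stdPoly (P.d j k))

end Presentation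

/-- (The presentation of) a G-algebra over `K` in `n` variables. -/
structure GAlgebra (K : Type*) [Field K] (n : ℕ) extends Presentation K n where
  c_ne_zero : ∀ i j : Fin n, i < j → c i j ≠ 0
  exists_admissible : ∃ m : MonomialOrder.{0, 0} (Fin n), toPresentation.Admissible m
  nondegenerate : ∀ i j k : Fin n, i < j → j < k →
    toPresentation.ReducesToZero (toPresentation.overlap i j k)

/-! ### Leading exponents and Gröbner bases

These notions are used for a ring `R` whose family `mon : E → R` of standard monomials, indexed by
a monoid `E` of exponents, is a `K`-basis, and for a strict total ordering `gt` of `E`. -/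

/-- The coefficients `c_α` in the representation `f = ∑ c_α mon α`. (The representation is unique,
and the choice made by `invFun` irrelevant, when `mon` is a `K`-basis of `R`.) -/
def coeffs (K : Type*) [Field K] {E R : Type*} [Ring R] [Algebra K R] (mon : E → R) (f : R) :
    E →₀ K :=
  Function.invFun (Finsupp.linearCombination K mon) f

/-- The Newton diagram of `f`. -/
def newton (K : Type*) [Field K] {E R : Type*} [Ring R] [Algebra K R] (mon : E → R) (f : R) :
    Finset E :=
  (coeffs K mon f).support

/-- `α = exp(f)` is the leading exponent of `f` (so that `f ≠ 0`). -/
def IsLeadExp (K : Type*) [Field K] {E R : Type*} [Ring R] [Algebra K R] (mon : E → R)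
    (gt : E → E → Prop) (f : R) (α : E) : Prop :=
  α ∈ newton K mon f ∧ ∀ β ∈ newton K mon f, β ≠ α → gt α β

/-- `exp(S) = {exp(f) | f ∈ S \ {0}}`. -/
def expSet (K : Type*) [Field K] {E R : Type*} [Ring R] [Algebra K R] (mon : E → R)
    (gt : E → E → Prop) (S : Set R) : Set E :=
  {α | ∃ f ∈ S, f ≠ 0 ∧ IsLeadExp K mon gt f α}

/-- `G` is a (left) Gröbner basis of the left ideal `I`: a finite subset of `I \ {0}` such that
`exp(I)` is the union of the sets `exp(g) + E`, `g ∈ G`. -/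
def IsGroebnerBasis (K : Type*) [Field K] {E R : Type*} [AddCommMonoid E] [Ring R] [Algebra K R]
    (mon : E → R) (gt : E → E → Prop) (I : Ideal R) (G : Set R) : Prop :=
  G.Finite ∧ G ⊆ (I : Set R) \ {0} ∧
    expSet K mon gt (I : Set R) =
      {α | ∃ g ∈ G, ∃ γ β : E, IsLeadExp K mon gt g γ ∧ α = γ + β}

namespace GAlgebra

variable {K : Type*} [Field K] {n : ℕ} (A : GAlgebra K n)

/-- The algebra `K⟨x₁, …, xₙ | x_j x_i = c_{ij} x_i x_j + d_{ij}, i < j⟩`. -/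
def Alg : Type _ := RingQuot A.Rel

instance : Ring A.Alg := inferInstanceAs (Ring (RingQuot A.Rel))

instance : Algebra K A.Alg := inferInstanceAs (Algebra K (RingQuot A.Rel))

/-- The quotient map `K⟨x⟩ → A`. -/
def proj : Free K n →ₐ[K] A.Alg := RingQuot.mkAlgHom K A.Rel

/-- The generator `xᵢ` of `A`. -/
def x (i : Fin n) : A.Alg := A.proj (freeVar i)

/-- The class of the standard monomial `x^α` in `A`. -/
def mon (α : Expo n) : A.Alg := stdMon A.x α

/-- A weight vector `ω ∈ ℕⁿ` with positive entries such that `ω_i + ω_j > |α|_ω` for all `i < j`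
and all exponents `α` of `d_{ij}`. -/
structure Weight where
  w : Fin n → ℕ
  one_le : ∀ i, 1 ≤ w i
  lt_of_mem : ∀ i j : Fin n, i < j → ∀ α ∈ (A.d i j).support, wt w α < w i + w j

variable {A} (ω : A.Weight)

/-- The `ω`-filtration `F_d A`, the elements of `A` of weighted degree at most `d`: the combinations
of the standard monomials `x^α` with `|α|_ω ≤ d`. -/
def filt (d : ℕ) : Submodule K A.Alg := Submodule.span K (A.mon '' {α | wt ω.w α ≤ d})

/-- `deg_ω(f)` for `f ≠ 0`; for `f = 0` the value is `0`. -/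
def deg (f : A.Alg) : ℕ := (newton K A.mon f).sup (wt ω.w)

/-! Every element of `A` is a combination of standard monomials, and `F_d A · F_e A ⊆ F_{d+e} A`:
both are needed for the Rees algebra and for homogenization to be defined. -/

/-- The nondecreasing word with exponent `α`. -/
def stdList {n : ℕ} (α : Expo n) : List (Fin n) :=
  (List.ofFn fun i => List.replicate (α i) i).flatten

theorem mon_eq (A : GAlgebra K n) (α : Expo n) : A.mon α = ((stdList α).map A.x).prod := by
  simp only [mon, stdMon, stdList, List.map_flatten, List.prod_flatten, List.map_ofFn]
  congr 2
  funext i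
  simp

theorem wt_eq (w : Fin n → ℕ) (α : Expo n) : ((stdList α).map w).sum = wt w α := by
  simp only [wt, stdList, List.map_flatten, List.sum_flatten, List.map_ofFn,
    List.sum_ofFn]
  refine Finset.sum_congr rfl fun i _ => ?_
  simp [mul_comm]

theorem count_stdList (α : Expo n) (i : Fin n) : (stdList α).count i = α i := by
  simp only [stdList, List.count_flatten, List.map_ofFn, List.sum_ofFn, Function.comp_apply,
    List.count_replicate]
  simp

theorem proj_stdPoly (A : GAlgebra K n) (p : Expo n →₀ K) :
    A.proj (stdPoly p) = Finsupp.linearCombination K A.mon p := by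
  simp only [stdPoly, Finsupp.linearCombination_apply, Finsupp.sum, map_sum, map_smul]
  refine Finset.sum_congr rfl fun α _ => ?_
  congr 1
  simp only [mon, stdMon, map_list_prod, List.map_ofFn]
  congr 2
  funext i
  simp [x]

theorem x_mul_x (A : GAlgebra K n) {i j : Fin n} (h : i < j) :
    A.x j * A.x i = A.c i j • (A.x i * A.x j) + Finsupp.linearCombination K A.mon (A.d i j) := by
  have := RingQuot.mkAlgHom_rel K (Presentation.Rel.comm (P := A.toPresentation) i j h)
  change A.proj _ = A.proj _ at this
  rw [map_mul, map_add, map_smul, map_mul, proj_stdPoly] at this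
  exact this

theorem filt_mono {d e : ℕ} (h : d ≤ e) : filt ω d ≤ filt ω e :=
  Submodule.span_mono (Set.image_mono fun _ hα => le_trans hα h)

theorem mon_mem_filt (α : Expo n) : A.mon α ∈ filt ω (wt ω.w α) :=
  Submodule.subset_span ⟨α, le_refl (wt ω.w α), rfl⟩

theorem swap_mem_aux (N : ℕ)
    (ih : ∀ l : List (Fin n), (l.map ω.w).sum < N →
      (l.map A.x).prod ∈ filt ω (l.map ω.w).sum)
    (u v : List (Fin n)) {i j : Fin n} (h : i < j)
    (hN : ((u ++ i :: j :: v).map ω.w).sum = N) :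
    ((u ++ i :: j :: v).map A.x).prod ∈ filt ω N ↔
      ((u ++ j :: i :: v).map A.x).prod ∈ filt ω N := by
  have e : ((u ++ j :: i :: v).map A.x).prod
      = A.c i j • ((u ++ i :: j :: v).map A.x).prod
        + (u.map A.x).prod * Finsupp.linearCombination K A.mon (A.d i j) * (v.map A.x).prod := by
    have h1 : ((u ++ j :: i :: v).map A.x).prod
        = (u.map A.x).prod * (A.x j * A.x i) * (v.map A.x).prod := by simp [mul_assoc]
    have h2 : ((u ++ i :: j :: v).map A.x).prod
        = (u.map A.x).prod * (A.x i * A.x j) * (v.map A.x).prod := by simp [mul_assoc]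
    rw [h1, h2, x_mul_x A h, mul_add, add_mul, mul_smul_comm, smul_mul_assoc]
  have hlow : (u.map A.x).prod * Finsupp.linearCombination K A.mon (A.d i j) * (v.map A.x).prod
      ∈ filt ω N := by
    rw [Finsupp.linearCombination_apply, Finsupp.sum, Finset.mul_sum, Finset.sum_mul]
    refine Submodule.sum_mem _ fun α hα => ?_
    rw [mul_smul_comm, smul_mul_assoc]
    refine Submodule.smul_mem _ _ ?_
    have hlt := ω.lt_of_mem i j h α hα
    have hw : ((u ++ stdList α ++ v).map ω.w).sum < N := by
      rw [← hN]
      simp only [List.map_append, List.sum_append, wt_eq, List.map_cons, List.sum_cons]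
      omega
    have := filt_mono ω hw.le (ih _ hw)
    simpa [mon_eq, mul_assoc] using this
  rw [e, Submodule.add_mem_iff_left _ hlow, Submodule.smul_mem_iff _ (A.c_ne_zero i j h)]

theorem perm_mem_aux (N : ℕ)
    (ih : ∀ l : List (Fin n), (l.map ω.w).sum < N →
      (l.map A.x).prod ∈ filt ω (l.map ω.w).sum)
    {l₁ l₂ : List (Fin n)} (hp : l₁.Perm l₂) :
    ∀ u : List (Fin n), ((u ++ l₁).map ω.w).sum = N →
      (((u ++ l₁).map A.x).prod ∈ filt ω N ↔ ((u ++ l₂).map A.x).prod ∈ filt ω N) := by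
  induction hp with
  | nil => intro u _; exact Iff.rfl
  | cons a _ hi =>
    intro u hu
    have := hi (u ++ [a]) (by simpa using hu)
    simpa using this
  | swap a b l =>
    intro u hu
    rcases lt_trichotomy a b with h | h | h
    · refine (swap_mem_aux ω N ih u l h ?_).symm
      rw [← hu]; simp only [List.map_append, List.sum_append, List.map_cons, List.sum_cons]; omega
    · subst h; exact Iff.rfl
    · exact swap_mem_aux ω N ih u l h hu
  | trans h₁ _ hi₁ hi₂ =>
    intro u hu
    refine (hi₁ u hu).trans (hi₂ u ?_)
    rw [← hu]
    exact (((h₁.append_left u).map ω.w).sum_eq).symm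

/-- A product of generators lies in the step of the filtration given by its total weight. -/
theorem list_prod_mem_filt (l : List (Fin n)) :
    (l.map A.x).prod ∈ filt ω (l.map ω.w).sum := by
  induction hN : (l.map ω.w).sum using Nat.strong_induction_on generalizing l with
  | _ N ih =>
    let α : Expo n := Finsupp.equivFunOnFinite.symm fun i => l.count i
    have hp : l.Perm (stdList α) := by
      rw [List.perm_iff_count]
      intro i
      rw [count_stdList]
      rfl
    have key := perm_mem_aux ω N (fun l' hl' => ih _ hl' l' rfl) hp [] (by simpa using hN)
    simp only [List.nil_append] at key
    rw [key, ← mon_eq]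
    have hw : wt ω.w α = N := by
      rw [← wt_eq, ← hN]
      exact ((hp.map ω.w).sum_eq).symm
    rw [← hw]
    exact mon_mem_filt ω α

theorem one_mem_filt : (1 : A.Alg) ∈ filt ω 0 := by
  simpa using list_prod_mem_filt ω ([] : List (Fin n))

theorem mul_mem_filt {d e : ℕ} {f g : A.Alg} (hf : f ∈ filt ω d) (hg : g ∈ filt ω e) :
    f * g ∈ filt ω (d + e) := by
  have h : filt ω d * filt ω e ≤ filt ω (d + e) := by
    rw [filt, filt, Submodule.span_mul_span, Submodule.span_le]
    rintro _ ⟨_, ⟨α, hα, rfl⟩, _, ⟨β, hβ, rfl⟩, rfl⟩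
    have := list_prod_mem_filt (A := A) ω (stdList α ++ stdList β)
    simp only [List.map_append, List.prod_append, List.sum_append, ← mon_eq, wt_eq] at this
    exact filt_mono ω (add_le_add hα hβ) this
  exact h (Submodule.mul_mem_mul hf hg)

theorem exists_mem_filt (f : A.Alg) : ∃ d, f ∈ filt ω d := by
  obtain ⟨F, rfl⟩ := RingQuot.mkAlgHom_surjective K A.Rel f
  induction F using MonoidAlgebra.induction_on with
  | of w =>
    have h : ∀ w : FreeMonoid (Fin n), A.proj (word w) = (w.toList.map A.x).prod := by
      intro w
      induction w using FreeMonoid.inductionOn' with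
      | one =>
        have : (word 1 : Free K n) = 1 := map_one _
        rw [this, map_one]
        rfl
      | of_mul a w hi =>
        have : (word (FreeMonoid.of a * w) : Free K n) = freeVar a * word w := by
          simp [word, freeVar]
        rw [this, map_mul, hi]
        simp [x]
    exact ⟨(w.toList.map ω.w).sum, (h w).symm ▸ list_prod_mem_filt (A := A) ω w.toList⟩
  | add F G hF hG =>
    obtain ⟨d, hd⟩ := hF
    obtain ⟨e, he⟩ := hG
    refine ⟨max d e, ?_⟩
    rw [map_add]
    exact Submodule.add_mem _ (filt_mono ω (le_max_left _ _) hd)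
      (filt_mono ω (le_max_right _ _) he)
  | smul r F hF =>
    obtain ⟨d, hd⟩ := hF
    exact ⟨d, by rw [map_smul]; exact Submodule.smul_mem _ _ hd⟩

theorem linearCombination_coeffs {A : GAlgebra K n} (ω : A.Weight) (f : A.Alg) :
    Finsupp.linearCombination K A.mon (coeffs K A.mon f) = f := by
  apply Function.invFun_eq
  obtain ⟨d, hd⟩ := exists_mem_filt ω f
  have : f ∈ Submodule.span K (Set.range A.mon) :=
    Submodule.span_mono (Set.image_subset_range _ _) hd
  rwa [Finsupp.mem_span_range_iff_exists_finsupp] at this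

theorem mem_filt_deg (f : A.Alg) : f ∈ filt ω (deg ω f) := by
  have h := linearCombination_coeffs ω f
  rw [Finsupp.linearCombination_apply, Finsupp.sum] at h
  suffices hs : ∑ α ∈ (coeffs K A.mon f).support, coeffs K A.mon f α • A.mon α
      ∈ filt ω (deg ω f) by
    rwa [h] at hs
  refine Submodule.sum_mem _ fun α hα => Submodule.smul_mem _ _ ?_
  exact filt_mono ω (Finset.le_sup (f := wt ω.w) hα) (mon_mem_filt ω α)

/-! ### The Rees algebra -/

/-- The Rees algebra `⊕_d (F_d A) t^d`, a subalgebra of `A[t]`. -/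
def Rees : Subalgebra K A.Alg[X] where
  carrier := {F | ∀ d, F.coeff d ∈ filt ω d}
  mul_mem' {F G} hF hG d := by
    rw [Polynomial.coeff_mul]
    refine Submodule.sum_mem _ fun p hp => ?_
    rw [← Finset.HasAntidiagonal.mem_antidiagonal.mp hp]
    exact mul_mem_filt ω (hF _) (hG _)
  add_mem' {F G} hF hG d := by
    rw [Polynomial.coeff_add]
    exact Submodule.add_mem _ (hF d) (hG d)
  algebraMap_mem' r d := by
    rw [Polynomial.algebraMap_apply, Polynomial.coeff_C]
    split_ifs with h
    · rw [Algebra.algebraMap_eq_smul_one, h]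
      exact Submodule.smul_mem _ _ (one_mem_filt ω)
    · exact Submodule.zero_mem _

/-- For `f ∈ F_d A`, the element `f t^d` of the Rees algebra. -/
def mulT (d : ℕ) (f : A.Alg) (hf : f ∈ filt ω d) : Rees ω :=
  ⟨Polynomial.monomial d f, fun e => by
    rw [Polynomial.coeff_monomial]
    split_ifs with h
    · exact h ▸ hf
    · exact Submodule.zero_mem _⟩

/-- The generator `x̃ᵢ = xᵢ t^{ωᵢ}` of the Rees algebra. -/
def xTilde (i : Fin n) : Rees ω :=
  mulT ω (ω.w i) (A.x i) (by simpa using list_prod_mem_filt ω [i])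

/-- The generator `t` of the Rees algebra. -/
def tVar : Rees ω := mulT ω 1 1 (filt_mono ω zero_le_one (one_mem_filt ω))

/-- The standard monomial `x̃^α t^k` of the Rees algebra; exponents in `ℕ^{n+1}` are written as
pairs `(α, k)`. -/
def reesMon (αk : Expo n × ℕ) : Rees ω := stdMon (xTilde ω) αk.1 * tVar ω ^ αk.2

/-- The weighted degree `|(α, k)|_ω̃ = |α|_ω + k`, where `ω̃ = (ω, 1)`. -/
def wtTilde (αk : Expo n × ℕ) : ℕ := wt ω.w αk.1 + αk.2

/-- `F` is `ω̃`-homogeneous. -/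
def IsHomog (F : Rees ω) : Prop :=
  ∃ d, ∀ αk ∈ newton K (reesMon ω) F, wtTilde ω αk = d

/-- The homogenization `f^h = f t^{deg_ω(f)}` (with `0^h = 0`). -/
def homogenize (f : A.Alg) : Rees ω := mulT ω (deg ω f) f (mem_filt_deg ω f)

/-- The dehomogenization `F|_{t=1}`. -/
def dehomogenize (F : Rees ω) : A.Alg := (F : A.Alg[X]).eval 1

/-- The strict ordering `>` on `ℕⁿ` given by a monomial ordering. -/
def Gt (m : MonomialOrder (Fin n)) (α β : Expo n) : Prop := m.toSyn β < m.toSyn α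

/-- The ordering `>^h` on `ℕ^{n+1}`: compare `ω̃`-weighted degrees first, then the `ℕⁿ`-parts
by `>`. -/
def GtH (m : MonomialOrder (Fin n)) (αd βe : Expo n × ℕ) : Prop :=
  wtTilde ω βe < wtTilde ω αd ∨ (wtTilde ω αd = wtTilde ω βe ∧ Gt m αd.1 βe.1)

end GAlgebra
end GAlg

end

noncomputable section
open Polynomial
namespace GAlg

/-! ### Words -/

/-! A homogeneous element of the Rees algebra has the form `f t^d` with `f ∈ F_d A`, and its
exponents are the pairs `(α, d - |α|_ω)` with `α ∈ N(f)`. They all have the same weighted degree, so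
`>^h` compares them by `α` alone, and `f t^d` and `f` have the same leading exponent up to the last
coordinate (`isLeadExp_mulT_iff`). The ideal `J` is homogeneous (`component_mem`) and dehomogenizes
into `I` (`dehomogenize_mem`). It need not contain `g^h` for every `g ∈ I`, but it contains `g t^d`
for all large `d` (`exists_mulT_mem`), which is enough: `exp(I)` is the projection of `exp(J)` to
`ℕⁿ`, and projecting the description of `exp(J)` by `G` gives the claim.

Leading exponents make sense only because the standard monomials form bases. In `A` they span by the
filtration argument; their independence is Bergman's diamond lemma. A normal form is defined on
words and extended linearly; by induction on the size of words it kills every relation in every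
context (`extendWords_nf_rel`), the overlaps `x_k x_j x_i` being resolved by the non-degeneracy
condition. It therefore descends to `A` and separates standard polynomials
(`linearIndependent_mon`). The basis of the Rees algebra follows degree by degree. -/

/-- The exponent of a word. -/
def expo {n : ℕ} (l : List (Fin n)) : Expo n := (l.map fun i => Finsupp.single i 1).sum

/-- The number of inversions of a word. -/
def inversions {n : ℕ} : List (Fin n) → ℕ
  | [] => 0
  | a :: l => l.countP (· < a) + inversions l

/-- A list of letters, seen as an element of the free associative algebra. -/
def wordL (K : Type*) [Field K] {n : ℕ} (l : List (Fin n)) : Free K n := word (FreeMonoid.ofList l)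

section Words

variable {n : ℕ}

@[simp] theorem expo_append (u v : List (Fin n)) : expo (u ++ v) = expo u + expo v := by
  simp [expo]

@[simp] theorem expo_cons (i : Fin n) (v : List (Fin n)) :
    expo (i :: v) = Finsupp.single i 1 + expo v := by
  simp [expo]

@[simp] theorem expo_nil : expo ([] : List (Fin n)) = 0 := rfl

theorem expo_apply (l : List (Fin n)) (i : Fin n) : expo l i = l.count i := by
  induction l with
  | nil => simp
  | cons a l ih =>
    simp [ih, List.count_cons, Finsupp.single_apply, add_comm]

theorem expo_stdList (α : Expo n) : expo (GAlgebra.stdList α) = α := by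
  ext i
  rw [expo_apply, GAlgebra.count_stdList]

/-- A letter of the prefix sees the same multiset of letters to its right in both words, so only the
inversion between `j` and `i` changes. -/
theorem inversions_swap_lt {i j : Fin n} (h : i < j) (u v : List (Fin n)) :
    inversions (u ++ i :: j :: v) < inversions (u ++ j :: i :: v) := by
  induction u with
  | nil =>
    simp only [List.nil_append, inversions, List.countP_cons, decide_eq_true_eq, h, h.not_gt,
      if_true, if_false]
    omega
  | cons a u ih =>
    have hp : (u ++ i :: j :: v).Perm (u ++ j :: i :: v) := (List.Perm.swap _ _ _).append_left u
    simp only [List.cons_append, inversions, hp.countP_eq]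
    omega

theorem pairwise_stdList (α : Expo n) : (GAlgebra.stdList α).Pairwise (· ≤ ·) := by
  rw [GAlgebra.stdList, List.pairwise_flatten]
  constructor
  · intro l hl
    obtain ⟨i, rfl⟩ := (List.mem_ofFn' _ _).1 hl
    exact List.pairwise_replicate.2 (Or.inr le_rfl)
  · rw [List.pairwise_ofFn]
    intro i j hij a ha b hb
    rw [List.eq_of_mem_replicate ha, List.eq_of_mem_replicate hb]
    exact hij.le

/-- The size of a word: first its exponent, then its number of inversions. -/
def size (m : MonomialOrder (Fin n)) (l : List (Fin n)) : m.syn ×ₗ ℕ :=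
  toLex (m.toSyn (expo l), inversions l)

theorem size_lt_of_expo_lt (m : MonomialOrder (Fin n)) {l l' : List (Fin n)}
    (h : m.toSyn (expo l) < m.toSyn (expo l')) : size m l < size m l' :=
  Prod.Lex.toLex_lt_toLex.2 (Or.inl h)

theorem size_swap_lt (m : MonomialOrder (Fin n)) {i j : Fin n} (h : i < j)
    (u v : List (Fin n)) : size m (u ++ i :: j :: v) < size m (u ++ j :: i :: v) := by
  refine Prod.Lex.toLex_lt_toLex.2 (Or.inr ⟨congrArg m.toSyn ?_, inversions_swap_lt h u v⟩)
  simp only [expo_append, expo_cons]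
  abel

theorem toSyn_expo_lt (m : MonomialOrder (Fin n)) {a b : List (Fin n)}
    (h : m.toSyn (expo a) < m.toSyn (expo b)) (u v : List (Fin n)) :
    m.toSyn (expo (u ++ a ++ v)) < m.toSyn (expo (u ++ b ++ v)) := by
  simp only [expo_append, map_add]
  gcongr

end Words

/-! ### Words as a spanning set of the free algebra -/

section WordL

variable {K : Type*} [Field K] {n : ℕ}

theorem wordL_append (u v : List (Fin n)) : wordL K (u ++ v) = wordL K u * wordL K v := by
  simp [wordL, word]

theorem wordL_cons (i : Fin n) (v : List (Fin n)) :
    wordL K (i :: v) = freeVar i * wordL K v := by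
  simp [wordL, word, freeVar]

@[simp] theorem wordL_nil : wordL K ([] : List (Fin n)) = 1 := by
  simp only [wordL, word, FreeMonoid.ofList_nil, map_one]

theorem freeVar_eq_wordL (i : Fin n) : (freeVar i : Free K n) = wordL K [i] := rfl

theorem stdMon_freeVar (α : Expo n) :
    (stdMon freeVar α : Free K n) = wordL K (GAlgebra.stdList α) := by
  have h : ∀ l : List (Fin n), wordL K l = (l.map freeVar).prod := by
    intro l
    induction l with
    | nil => simp
    | cons a l ih => rw [wordL_cons, ih, List.map_cons, List.prod_cons]
  rw [h]
  simp only [stdMon, GAlgebra.stdList, List.map_flatten, List.prod_flatten, List.map_ofFn]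
  congr 2
  funext i
  simp

theorem stdPoly_eq (p : Expo n →₀ K) :
    (stdPoly p : Free K n) = p.sum fun α a => a • wordL K (GAlgebra.stdList α) := by
  simp only [stdPoly, Finsupp.linearCombination_apply, stdMon_freeVar]

/-- The linear extension to the free algebra of a map given on words. -/
def extendWords {V : Type*} [AddCommGroup V] [Module K V] (φ : List (Fin n) → V) :
    Free K n →ₗ[K] V :=
  (Finsupp.linearCombination K fun w : FreeMonoid (Fin n) => φ w.toList) ∘ₗ
    (MonoidAlgebra.coeffLinearEquiv K).toLinearMap

@[simp] theorem extendWords_wordL {V : Type*} [AddCommGroup V] [Module K V]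
    (φ : List (Fin n) → V) (l : List (Fin n)) : extendWords φ (wordL K l) = φ l := by
  simp [extendWords, wordL, word]

theorem span_wordL : Submodule.span K (Set.range (wordL K (n := n))) = ⊤ := by
  rw [eq_top_iff]
  rintro f -
  induction f using MonoidAlgebra.induction_on with
  | of w => exact Submodule.subset_span ⟨w.toList, rfl⟩
  | add f g hf hg => exact add_mem hf hg
  | smul r f hf => exact Submodule.smul_mem _ _ hf

theorem mem_of_coeff_ne_zero {s : Set (List (Fin n))} {f : Free K n}
    (hf : f ∈ Submodule.span K (wordL K '' s)) {w : FreeMonoid (Fin n)} (hw : f.coeff w ≠ 0) :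
    w.toList ∈ s := by
  contrapose! hw
  induction hf using Submodule.span_induction with
  | mem x hx =>
    obtain ⟨l, hl, rfl⟩ := hx
    have : FreeMonoid.ofList l ≠ w := by
      rintro rfl
      exact hw hl
    simp [wordL, word, this]
  | zero => rfl
  | add x y _ _ hx hy => simp [hx, hy]
  | smul a x _ hx => simp [hx]

end WordL

/-! ### Reduction to normal form -/

namespace Presentation

variable {K : Type*} [Field K] {n : ℕ} (P : Presentation K n) (m : MonomialOrder (Fin n))

/-- The right-hand side `c_{ij} x_i x_j + d_{ij}` of a relation. -/
def tail (i j : Fin n) : Free K n := P.c i j • (freeVar i * freeVar j) + stdPoly (P.d i j)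

/-- The difference of the two sides of a relation. -/
def rel (i j : Fin n) : Free K n := freeVar j * freeVar i - P.tail i j

open Classical in
/-- The normal form of a word: reduce at some descent as long as there is one. -/
def nf (w : List (Fin n)) : Expo n →₀ K :=
  if h : ∃ q : List (Fin n) × Fin n × Fin n × List (Fin n),
      q.2.1 < q.2.2.1 ∧ w = q.1 ++ q.2.2.1 :: q.2.1 :: q.2.2.2 then
    let q := h.choose
    -- The size tests make the recursion terminate for an arbitrary presentation. When `m` is
    -- admissible they always succeed, so the value 0 is never used.
    (P.c q.2.1 q.2.2.1 • if size m (q.1 ++ q.2.1 :: q.2.2.1 :: q.2.2.2) < size m w then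
        nf (q.1 ++ q.2.1 :: q.2.2.1 :: q.2.2.2) else 0) +
      (P.d q.2.1 q.2.2.1).sum fun α a =>
        a • if size m (q.1 ++ GAlgebra.stdList α ++ q.2.2.2) < size m w then
          nf (q.1 ++ GAlgebra.stdList α ++ q.2.2.2) else 0
  else Finsupp.single (expo w) 1
termination_by size m w
decreasing_by all_goals assumption

variable {P m}

theorem size_stdList_lt (hP : P.Admissible m) {i j : Fin n} (h : i < j) {α : Expo n}
    (hα : α ∈ (P.d i j).support) (u v : List (Fin n)) :
    size m (u ++ GAlgebra.stdList α ++ v) < size m (u ++ [j, i] ++ v) := by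
  refine size_lt_of_expo_lt m (toSyn_expo_lt m ?_ u v)
  simpa [expo_stdList, add_comm] using hP i j h α hα

theorem nf_of_pairwise {w : List (Fin n)} (hw : w.Pairwise (· ≤ ·)) :
    P.nf m w = Finsupp.single (expo w) 1 := by
  rw [nf, dif_neg]
  rintro ⟨⟨u, i, j, v⟩, hij, rfl⟩
  have := (List.pairwise_append.1 hw).2.1
  simp only [List.pairwise_cons, List.mem_cons] at this
  exact absurd (this.1 i (Or.inl rfl)) hij.not_ge

/-- The descent chosen by `nf` need not be the given one, hence the new context `u'`, `v'`. That the
choice is harmless is the content of confluence. -/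
theorem nf_of_descent (hP : P.Admissible m) {u v : List (Fin n)} {i j : Fin n} (hij : i < j) :
    ∃ (u' v' : List (Fin n)) (i' j' : Fin n), i' < j' ∧
      u ++ j :: i :: v = u' ++ j' :: i' :: v' ∧
      P.nf m (u ++ j :: i :: v)
        = extendWords (P.nf m) (wordL K u' * P.tail i' j' * wordL K v') := by
  have h : ∃ q : List (Fin n) × Fin n × Fin n × List (Fin n),
      q.2.1 < q.2.2.1 ∧ u ++ j :: i :: v = q.1 ++ q.2.2.1 :: q.2.1 :: q.2.2.2 :=
    ⟨⟨u, i, j, v⟩, hij, rfl⟩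
  refine ⟨h.choose.1, h.choose.2.2.2, h.choose.2.1, h.choose.2.2.1, h.choose_spec.1,
    h.choose_spec.2, ?_⟩
  rw [nf, dif_pos h]
  have hs := h.choose_spec
  generalize h.choose = q at hs
  obtain ⟨u', i', j', v'⟩ := q
  obtain ⟨hij', e⟩ := hs
  simp only at hij' e ⊢
  rw [e, if_pos (size_swap_lt m hij' u' v')]
  simp only [tail, stdPoly_eq, mul_add, add_mul, map_add, Finsupp.sum, Finset.mul_sum,
    Finset.sum_mul, map_sum, mul_smul_comm, smul_mul_assoc, map_smul]
  congr 1
  · congr 1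
    rw [← extendWords_wordL (K := K) (P.nf m)]
    simp only [wordL_append, wordL_cons, mul_assoc]
  · refine Finset.sum_congr rfl fun α hα => ?_
    rw [if_pos (by simpa using size_stdList_lt hP hij' hα u' v'),
      ← extendWords_wordL (K := K) (P.nf m)]
    simp only [wordL_append]

/-! ### The diamond lemma -/

variable (K) in
/-- Combinations of words that are smaller than `b` in every context. -/
def below (m : MonomialOrder (Fin n)) (b : List (Fin n)) : Submodule K (Free K n) :=
  Submodule.span K (wordL K '' {a | ∀ u v, size m (u ++ a ++ v) < size m (u ++ b ++ v)})

variable (P m) in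
/-- Combinations of the `u (x_j x_i - c_{ij} x_i x_j - d_{ij}) v` where `u x_j x_i v` is smaller
than `s`. -/
def relsBelow (s : m.syn ×ₗ ℕ) : Submodule K (Free K n) :=
  Submodule.span K {z | ∃ (u v : List (Fin n)) (i j : Fin n), i < j ∧
    size m (u ++ j :: i :: v) < s ∧ z = wordL K u * P.rel i j * wordL K v}

theorem tail_mem_below (hP : P.Admissible m) {i j : Fin n} (h : i < j) :
    P.tail i j ∈ below K m [j, i] := by
  refine add_mem (Submodule.smul_mem _ _ (Submodule.subset_span ⟨[i, j], fun u v => ?_, ?_⟩)) ?_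
  · simpa using size_swap_lt m h u v
  · simp [wordL_cons]
  · rw [stdPoly_eq]
    refine Submodule.sum_mem _ fun α hα => Submodule.smul_mem _ _ (Submodule.subset_span
      ⟨_, fun u v => size_stdList_lt hP h hα u v, rfl⟩)

/-- Since `below` compares words in every context, replacing `b` by a term of `z` makes the whole
word smaller, also when a relation is applied further to the right. -/
theorem mul_rel_mem_relsBelow {z : Free K n} {b : List (Fin n)} (hz : z ∈ below K m b)
    (u v w : List (Fin n)) {i j : Fin n} (h : i < j) :
    wordL K u * z * wordL K w * P.rel i j * wordL K v
      ∈ P.relsBelow m (size m (u ++ b ++ w ++ j :: i :: v)) := by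
  induction hz using Submodule.span_induction with
  | mem x hx =>
    obtain ⟨a, ha, rfl⟩ := hx
    refine Submodule.subset_span ⟨u ++ a ++ w, v, i, j, h, ?_, ?_⟩
    · simpa using ha u (w ++ j :: i :: v)
    · simp only [wordL_append]
  | zero => simp
  | add x y _ _ hx hy => simpa only [mul_add, add_mul] using add_mem hx hy
  | smul a x _ hx =>
    simpa only [mul_smul_comm, smul_mul_assoc] using Submodule.smul_mem _ a hx

theorem rel_mul_mem_relsBelow {z : Free K n} {b : List (Fin n)} (hz : z ∈ below K m b)
    (u v w : List (Fin n)) {i j : Fin n} (h : i < j) :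
    wordL K u * P.rel i j * wordL K w * z * wordL K v
      ∈ P.relsBelow m (size m (u ++ j :: i :: (w ++ b ++ v))) := by
  induction hz using Submodule.span_induction with
  | mem x hx =>
    obtain ⟨a, ha, rfl⟩ := hx
    refine Submodule.subset_span ⟨u, w ++ a ++ v, i, j, h, ?_, ?_⟩
    · simpa using ha (u ++ j :: i :: w) v
    · simp only [wordL_append, mul_assoc]
  | zero => simp
  | add x y _ _ hx hy => simpa only [mul_add, add_mul] using add_mem hx hy
  | smul a x _ hx =>
    simpa only [mul_smul_comm, smul_mul_assoc] using Submodule.smul_mem _ a hx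

/-- Descents without a common letter commute: substituting `x_j x_i = rel + tail` for both leaves
`tail_{kl} w rel_{ij} - rel_{kl} w tail_{ij}`, where each relation stands next to something already
reduced. -/
theorem disjoint_mem_relsBelow (hP : P.Admissible m) (u v w : List (Fin n)) {i j k l : Fin n}
    (hij : i < j) (hkl : k < l) :
    wordL K u * P.tail k l * wordL K (w ++ j :: i :: v)
        - wordL K (u ++ l :: k :: w) * P.tail i j * wordL K v
      ∈ P.relsBelow m (size m (u ++ l :: k :: (w ++ j :: i :: v))) := by
  have h1 := mul_rel_mem_relsBelow (P := P) (tail_mem_below hP hkl) u v w hij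
  have h2 := rel_mul_mem_relsBelow (P := P) (tail_mem_below hP hij) u v w hkl
  have h3 := sub_mem (by simpa using h1 : _ ∈ P.relsBelow m (size m (u ++ l :: k :: (w ++ j :: i :: v))))
    (by simpa using h2 : _ ∈ P.relsBelow m (size m (u ++ l :: k :: (w ++ j :: i :: v))))
  convert h3 using 1
  simp only [wordL_append, wordL_cons, rel, mul_sub, sub_mul, mul_assoc]
  abel

/-- If an element with all words of exponent less than `e` reduces to zero, then it is a
combination of relations in contexts of exponent less than `e`. -/
theorem mem_span_of_reducesToZero (hP : P.Admissible m) (e : Expo n) {f : Free K n}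
    (hf : f ∈ Submodule.span K (wordL K '' {a | m.toSyn (expo a) < m.toSyn e}))
    (hr : P.ReducesToZero f) :
    f ∈ Submodule.span K {z | ∃ (u v : List (Fin n)) (i j : Fin n), i < j ∧
      m.toSyn (expo (u ++ j :: i :: v)) < m.toSyn e ∧
      z = wordL K u * P.rel i j * wordL K v} := by
  induction hr using Relation.ReflTransGen.head_induction_on with
  | refl => exact Submodule.zero_mem _
  | head hs _ ih =>
    rename_i f g _
    obtain ⟨i, j, u, v, a, hij, ha, hac, hg⟩ := hs
    -- The rewritten word occurs in `f` with nonzero coefficient `a`, so its exponent is below `e`.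
    -- The relation then involves only such words, and the bound passes on to `g`.
    have hw := mem_of_coeff_ne_zero hf (hac ▸ ha)
    have hw' : m.toSyn (expo (u.toList ++ j :: i :: v.toList)) < m.toSyn e := by
      simpa [FreeMonoid.toList_mul] using hw
    have hu : (word u : Free K n) = wordL K u.toList := rfl
    have hv : (word v : Free K n) = wordL K v.toList := rfl
    have hfg : f = g + a • (wordL K u.toList * P.rel i j * wordL K v.toList) := by
      rw [hg, hu, hv, rel, tail]
      simp only [mul_sub, sub_mul, smul_sub]
      abel
    have hrel : wordL K u.toList * P.rel i j * wordL K v.toList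
        ∈ Submodule.span K (wordL K '' {a | m.toSyn (expo a) < m.toSyn e}) := by
      rw [rel, mul_sub, sub_mul]
      refine sub_mem (Submodule.subset_span ⟨_, hw', ?_⟩) ?_
      · simp only [wordL_append, wordL_cons, mul_assoc]
      · simp only [tail, stdPoly_eq, mul_add, add_mul, Finsupp.sum, Finset.mul_sum,
          Finset.sum_mul, mul_smul_comm, smul_mul_assoc]
        refine add_mem (Submodule.smul_mem _ _ (Submodule.subset_span
          ⟨u.toList ++ i :: j :: v.toList, ?_, ?_⟩)) (Submodule.sum_mem _ fun α hα =>
            Submodule.smul_mem _ _ (Submodule.subset_span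
              ⟨u.toList ++ GAlgebra.stdList α ++ v.toList, ?_, ?_⟩))
        · refine lt_of_eq_of_lt (congrArg m.toSyn ?_) hw'
          simp only [expo_append, expo_cons]
          abel
        · simp only [wordL_append, wordL_cons, mul_assoc]
        · refine lt_trans (toSyn_expo_lt m (b := [j, i]) ?_ _ _) (by simpa using hw')
          simpa [expo_stdList, add_comm] using hP i j hij α hα
        · simp only [wordL_append]
    have hmem : g ∈ Submodule.span K (wordL K '' {a | m.toSyn (expo a) < m.toSyn e}) := by
      rw [eq_sub_of_add_eq hfg.symm]
      exact sub_mem hf (Submodule.smul_mem _ _ hrel)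
    rw [hfg]
    exact add_mem (ih hmem)
      (Submodule.smul_mem _ _ (Submodule.subset_span ⟨_, _, i, j, hij, hw', rfl⟩))

theorem stdPoly_mem_span (hP : P.Admissible m) {i j : Fin n} (h : i < j) (u v : List (Fin n))
    {e : Expo n} (he : expo (u ++ [j, i] ++ v) = e) :
    wordL K u * stdPoly (P.d i j) * wordL K v
      ∈ Submodule.span K (wordL K '' {a | m.toSyn (expo a) < m.toSyn e}) := by
  simp only [stdPoly_eq, Finsupp.sum, Finset.mul_sum,
          Finset.sum_mul, mul_smul_comm, smul_mul_assoc]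
  refine Submodule.sum_mem _ fun α hα => Submodule.smul_mem _ _ (Submodule.subset_span
    ⟨u ++ GAlgebra.stdList α ++ v, ?_, by simp only [wordL_append]⟩)
  rw [← he]
  refine toSyn_expo_lt m ?_ _ _
  simpa [expo_stdList, add_comm] using hP i j h α hα

/-- Each of the six terms is some `d` times the missing variable, and admissibility puts the
exponents of `d` strictly below those of the two variables it comes from. -/
theorem overlap_mem_span (hP : P.Admissible m) {i j k : Fin n} (hij : i < j) (hjk : j < k) :
    P.overlap i j k ∈ Submodule.span K
      (wordL K '' {a | m.toSyn (expo a) < m.toSyn (expo [k, j, i])}) := by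
  have h1 := stdPoly_mem_span hP hij [] [k] (e := expo [k, j, i]) (by simp; abel)
  have h2 := stdPoly_mem_span hP hij [k] [] (e := expo [k, j, i]) (by simp)
  have h3 := stdPoly_mem_span hP (hij.trans hjk) [j] [] (e := expo [k, j, i]) (by simp; abel)
  have h4 := stdPoly_mem_span hP (hij.trans hjk) [] [j] (e := expo [k, j, i]) (by simp; abel)
  have h5 := stdPoly_mem_span hP hjk [] [i] (e := expo [k, j, i]) (by simp)
  have h6 := stdPoly_mem_span hP hjk [i] [] (e := expo [k, j, i]) (by simp; abel)
  simp only [wordL_nil, one_mul, mul_one, ← freeVar_eq_wordL] at h1 h2 h3 h4 h5 h6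
  exact sub_mem (add_mem (sub_mem (add_mem (sub_mem (Submodule.smul_mem _ _ h1) h2)
    (Submodule.smul_mem _ _ h3)) (Submodule.smul_mem _ _ h4)) h5) (Submodule.smul_mem _ _ h6)

/-- Both one-step reductions of `x_k x_j x_i` are sorted further. The two copies of `c_{ij} c_{ik}
c_{jk} x_i x_j x_k` cancel, and the lower terms left over form the overlap. -/
theorem overlap_identity (i j k : Fin n) :
    P.tail j k * freeVar i - freeVar k * P.tail i j
      = P.c j k • (freeVar j * P.rel i k) - P.c i j • (P.rel i k * freeVar j)
        + (P.c j k * P.c i k) • (P.rel i j * freeVar k)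
        - (P.c i j * P.c i k) • (freeVar i * P.rel j k) + P.overlap i j k := by
  simp only [rel, tail, overlap, mul_sub, sub_mul, mul_add, add_mul, smul_sub, smul_add,
    mul_smul_comm, smul_mul_assoc, smul_smul, mul_assoc]
  module

theorem overlap_mem_relsBelow (hP : P.Admissible m) {i j k : Fin n} (hij : i < j) (hjk : j < k)
    (hr : P.ReducesToZero (P.overlap i j k)) (u v : List (Fin n)) :
    wordL K u * P.tail j k * wordL K (i :: v) - wordL K (u ++ [k]) * P.tail i j * wordL K v
      ∈ P.relsBelow m (size m (u ++ k :: j :: i :: v)) := by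
  have hik := hij.trans hjk
  have e : wordL K u * P.tail j k * wordL K (i :: v)
        - wordL K (u ++ [k]) * P.tail i j * wordL K v
      = P.c j k • (wordL K (u ++ [j]) * P.rel i k * wordL K v)
        - P.c i j • (wordL K u * P.rel i k * wordL K (j :: v))
        + (P.c j k * P.c i k) • (wordL K u * P.rel i j * wordL K (k :: v))
        - (P.c i j * P.c i k) • (wordL K (u ++ [i]) * P.rel j k * wordL K v)
        + wordL K u * P.overlap i j k * wordL K v := by
    have := congrArg (fun z => wordL K u * z * wordL K v) (overlap_identity (P := P) i j k)
    simp only [mul_sub, sub_mul, mul_add, add_mul, mul_smul_comm, smul_mul_assoc] at this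
    simp only [wordL_append, wordL_cons, wordL_nil, mul_one, mul_assoc] at this ⊢
    exact this
  rw [e]
  -- These are the words at which the four relations of `overlap_identity` are applied; all arise
  -- from `x_k x_j x_i` by removing inversions.
  have t1 : size m (u ++ j :: k :: i :: v) < size m (u ++ k :: j :: i :: v) :=
    size_swap_lt m hjk u (i :: v)
  have t2 : size m (u ++ k :: i :: j :: v) < size m (u ++ k :: j :: i :: v) := by
    simpa using size_swap_lt m hij (u ++ [k]) v
  have t3 : size m (u ++ j :: i :: k :: v) < size m (u ++ k :: j :: i :: v) := by
    refine lt_trans ?_ t1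
    simpa using size_swap_lt m hik (u ++ [j]) v
  have t4 : size m (u ++ i :: k :: j :: v) < size m (u ++ k :: j :: i :: v) :=
    lt_trans (size_swap_lt m hik u (j :: v)) t2
  refine add_mem (sub_mem (add_mem (sub_mem
    (Submodule.smul_mem _ _ (Submodule.subset_span ⟨_, _, i, k, hik, by simpa using t1, rfl⟩))
    (Submodule.smul_mem _ _ (Submodule.subset_span ⟨_, _, i, k, hik, by simpa using t2, rfl⟩)))
    (Submodule.smul_mem _ _ (Submodule.subset_span ⟨_, _, i, j, hij, by simpa using t3, rfl⟩)))
    (Submodule.smul_mem _ _ (Submodule.subset_span ⟨_, _, j, k, hjk, by simpa using t4, rfl⟩))) ?_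
  -- The overlap is a combination of relations at words of strictly smaller exponent, which are
  -- smaller in `size` whatever their number of inversions.
  have ho := mem_span_of_reducesToZero hP _ (overlap_mem_span hP hij hjk) hr
  generalize P.overlap i j k = z at ho
  induction ho using Submodule.span_induction with
  | mem x hx =>
    obtain ⟨u', v', i', j', hij', hs, rfl⟩ := hx
    refine Submodule.subset_span ⟨u ++ u', v' ++ v, i', j', hij', ?_, ?_⟩
    · simpa using size_lt_of_expo_lt m (toSyn_expo_lt m hs u v)
    · simp only [wordL_append, mul_assoc]
  | zero => simp
  | add x y _ _ hx hy => simpa only [mul_add, add_mul] using add_mem hx hy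
  | smul a x _ hx =>
    simpa only [mul_smul_comm, smul_mul_assoc] using Submodule.smul_mem _ a hx

/-- Two reductions of the same word agree modulo smaller relations. -/
theorem reductions_sub_mem (hP : P.Admissible m)
    (hr : ∀ i j k : Fin n, i < j → j < k → P.ReducesToZero (P.overlap i j k))
    {u v u' v' : List (Fin n)} {i j i' j' : Fin n} (h : i < j) (h' : i' < j')
    (e : u ++ j :: i :: v = u' ++ j' :: i' :: v') :
    wordL K u * P.tail i j * wordL K v - wordL K u' * P.tail i' j' * wordL K v'
      ∈ P.relsBelow m (size m (u ++ j :: i :: v)) := by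
  wlog hle : u.length ≤ u'.length generalizing u v i j u' v' i' j'
  · have := this h' h e.symm (le_of_not_ge hle)
    rw [← e] at this
    simpa using neg_mem this
  -- The word `a` measures how far the second descent lies to the right of the first: length 0 means
  -- the same descent, length 1 one shared letter, length at least 2 disjoint descents.
  rcases List.append_eq_append_iff.1 e with ⟨a, rfl, ha⟩ | ⟨a, rfl, ha⟩
  · match a, ha with
    | [], ha =>
      simp only [List.nil_append, List.cons.injEq] at ha
      obtain ⟨rfl, rfl, rfl⟩ := ha
      simp
    | [b], ha =>
      simp only [List.cons_append, List.nil_append, List.cons.injEq] at ha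
      obtain ⟨rfl, rfl, rfl⟩ := ha
      exact overlap_mem_relsBelow hP h' h (hr _ _ _ h' h) u v'
    | b :: c :: a, ha =>
      simp only [List.cons_append, List.cons.injEq] at ha
      obtain ⟨rfl, rfl, rfl⟩ := ha
      exact disjoint_mem_relsBelow hP u v' a h' h
  · have : a = [] := by
      simp only [List.length_append] at hle
      exact List.eq_nil_of_length_eq_zero (by omega)
    subst this
    simp only [List.nil_append, List.cons.injEq] at ha
    obtain ⟨rfl, rfl, rfl⟩ := ha
    simp

/-- By induction the normal form kills all relations at smaller words. Any two one-step reductions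
of a word therefore have the same normal form, and one of them is the reduction that `nf` uses. -/
theorem extendWords_nf_rel (hP : P.Admissible m)
    (hr : ∀ i j k : Fin n, i < j → j < k → P.ReducesToZero (P.overlap i j k))
    (u v : List (Fin n)) {i j : Fin n} (h : i < j) :
    extendWords (P.nf m) (wordL K u * P.rel i j * wordL K v) = 0 := by
  induction hs : size m (u ++ j :: i :: v) using WellFoundedLT.induction generalizing u v i j with
  | _ s ih =>
    have hker : P.relsBelow m s ≤ LinearMap.ker (extendWords (P.nf m)) := by
      refine Submodule.span_le.2 ?_
      rintro _ ⟨u', v', i', j', h', hlt, rfl⟩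
      exact ih _ hlt u' v' h' rfl
    obtain ⟨u', v', i', j', h', e, hnf⟩ := nf_of_descent hP (u := u) (v := v) h
    have := hker (hs ▸ reductions_sub_mem hP hr h h' e)
    rw [LinearMap.mem_ker, map_sub, sub_eq_zero] at this
    rw [rel, mul_sub, sub_mul, map_sub, this, ← hnf, sub_eq_zero, ← extendWords_wordL (K := K) (P.nf m)]
    simp only [wordL_append, wordL_cons, mul_assoc]

end Presentation

/-! ### Passage to the quotient and linear independence -/

namespace GAlgebra

variable {K : Type*} [Field K] {n : ℕ} (A : GAlgebra K n)

/-- A linear map on the free algebra that kills the relations in all contexts factors through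
the quotient. -/
theorem eq_of_proj_eq {V : Type*} [AddCommGroup V] [Module K V] (φ : Free K n →ₗ[K] V)
    (h : ∀ (u v : List (Fin n)) (i j : Fin n), i < j →
      φ (wordL K u * A.rel i j * wordL K v) = 0)
    {a b : Free K n} (hab : A.proj a = A.proj b) : φ a = φ b := by
  have h' : ∀ (x y : Free K n) (i j : Fin n), i < j → φ (x * A.rel i j * y) = 0 := by
    intro x y i j hij
    have hx : x ∈ Submodule.span K (Set.range (wordL K (n := n))) := span_wordL (K := K) (n := n) ▸ Submodule.mem_top
    have hy : y ∈ Submodule.span K (Set.range (wordL K (n := n))) := span_wordL (K := K) (n := n) ▸ Submodule.mem_top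
    induction hx using Submodule.span_induction with
    | mem x hx =>
      obtain ⟨u, rfl⟩ := hx
      induction hy using Submodule.span_induction with
      | mem y hy =>
        obtain ⟨v, rfl⟩ := hy
        exact h u v i j hij
      | zero => simp
      | add y z _ _ hy hz => rw [mul_add, map_add, hy, hz, add_zero]
      | smul a y _ hy => rw [mul_smul_comm, map_smul, hy, smul_zero]
    | zero => simp
    | add x z _ _ hx hz => rw [add_mul, add_mul, map_add, hx, hz, add_zero]
    | smul a x _ hx => rw [smul_mul_assoc, smul_mul_assoc, map_smul, hx, smul_zero]
  -- The context `x`, `y` is part of the claim so that the induction absorbs the one-sided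
  -- multiplications generating `RingQuot.Rel`.
  have key : ∀ p q : Free K n, RingQuot.Rel A.Rel p q → ∀ x y, φ (x * p * y) = φ (x * q * y) := by
    intro p q hpq
    induction hpq with
    | of hpq =>
      obtain ⟨i, j, hij⟩ := hpq
      intro x y
      have := h' x y i j hij
      rwa [Presentation.rel, mul_sub, sub_mul, map_sub, sub_eq_zero] at this
    | add_left _ ih => intro x y; simp only [mul_add, add_mul, map_add, ih]
    | mul_left _ ih => intro x y; simpa only [mul_assoc] using ih x (_ * y)
    | mul_right _ ih => intro x y; simpa only [mul_assoc] using ih (x * _) y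
  have hq : Relation.EqvGen (RingQuot.Rel A.Rel) a b := by
    apply Quot.eqvGen_exact
    have : RingQuot.mkAlgHom K A.Rel a = RingQuot.mkAlgHom K A.Rel b := hab
    simpa [RingQuot.mkAlgHom_def, RingQuot.mkRingHom_def] using this
  clear hab
  induction hq with
  | rel p q hpq => simpa using key p q hpq 1 1
  | refl => rfl
  | symm _ _ _ ih => exact ih.symm
  | trans _ _ _ _ _ ih₁ ih₂ => exact ih₁.trans ih₂

/-- The standard monomials of a G-algebra are linearly independent. -/
theorem linearIndependent_mon : LinearIndependent K A.mon := by
  obtain ⟨m, hm⟩ := A.exists_admissible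
  -- Standard words are their own normal forms, so the normal form map is a left inverse of
  -- `stdPoly`.
  have hN : ∀ p : Expo n →₀ K, extendWords (A.nf m) (stdPoly p) = p := by
    intro p
    simp only [stdPoly_eq, Finsupp.sum, map_sum, map_smul, extendWords_wordL,
      Presentation.nf_of_pairwise (pairwise_stdList _), expo_stdList]
    simpa [Finsupp.sum] using p.sum_single
  intro p q hpq
  rw [← hN p, ← hN q]
  refine A.eq_of_proj_eq _ (fun u v i j hij =>
    Presentation.extendWords_nf_rel hm A.nondegenerate u v hij) ?_
  rw [proj_stdPoly, proj_stdPoly]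
  exact hpq

end GAlgebra
end GAlg
namespace GAlg

/-- For a basis the preimage picked by `invFun` is unique; from here on Newton diagrams can be
computed with `repr`. -/
theorem coeffs_eq_repr {K : Type*} [Field K] {E R : Type*} [Ring R] [Algebra K R]
    (b : Module.Basis E K R) (f : R) : coeffs K b f = b.repr f := by
  have h : Finsupp.linearCombination K b (coeffs K b f) = f :=
    Function.invFun_eq ⟨b.repr f, b.linearCombination_repr f⟩
  rw [← b.repr_linearCombination (coeffs K b f), h]

namespace GAlgebra

variable {K : Type*} [Field K] {n : ℕ} {A : GAlgebra K n} (ω : A.Weight)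

/-! ### The basis of standard monomials of `A` -/

/-- The standard monomials as a basis of `A`. -/
def monBasis : Module.Basis (Expo n) K A.Alg :=
  Module.Basis.mk A.linearIndependent_mon fun f _ => by
    rw [← Finsupp.range_linearCombination]
    exact ⟨_, linearCombination_coeffs ω f⟩

@[simp] theorem coe_monBasis : ⇑(monBasis ω) = A.mon := Module.Basis.coe_mk _ _

theorem mem_newton_iff {f : A.Alg} {α : Expo n} :
    α ∈ newton K A.mon f ↔ (monBasis ω).repr f α ≠ 0 := by
  rw [newton, ← coe_monBasis ω, coeffs_eq_repr, Finsupp.mem_support_iff]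

theorem wt_le_of_mem_filt {d : ℕ} {f : A.Alg} (hf : f ∈ filt ω d) {α : Expo n}
    (hα : (monBasis ω).repr f α ≠ 0) : wt ω.w α ≤ d := by
  rw [filt, ← coe_monBasis ω, Module.Basis.mem_span_image] at hf
  exact hf (Finsupp.mem_support_iff.2 hα)

/-! ### Homogeneous elements of the Rees algebra -/

@[simp] theorem coe_mulT (d : ℕ) (f : A.Alg) (hf : f ∈ filt ω d) :
    (mulT ω d f hf : A.Alg[X]) = monomial d f := rfl

theorem mulT_mul_mulT {d e : ℕ} {f g : A.Alg} (hf : f ∈ filt ω d) (hg : g ∈ filt ω e) :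
    mulT ω d f hf * mulT ω e g hg = mulT ω (d + e) (f * g) (mul_mem_filt ω hf hg) :=
  Subtype.ext (monomial_mul_monomial d e f g)

theorem mulT_congr {d e : ℕ} {f g : A.Alg} (hf : f ∈ filt ω d) (hg : g ∈ filt ω e)
    (hde : d = e) (hfg : f = g) : mulT ω d f hf = mulT ω e g hg := by
  subst hde hfg
  rfl

theorem mulT_add {d : ℕ} {f g : A.Alg} (hf : f ∈ filt ω d) (hg : g ∈ filt ω d) :
    mulT ω d (f + g) (add_mem hf hg) = mulT ω d f hf + mulT ω d g hg :=
  Subtype.ext (map_add (monomial d) f g)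

theorem mulT_eq_zero_iff {d : ℕ} {f : A.Alg} (hf : f ∈ filt ω d) :
    mulT ω d f hf = 0 ↔ f = 0 := by
  rw [← Subtype.coe_inj]
  exact monomial_eq_zero_iff f d

/-- The homogeneous component of degree `d` of an element of the Rees algebra. -/
def component (d : ℕ) (F : Rees ω) : Rees ω := mulT ω d ((F : A.Alg[X]).coeff d) (F.2 d)

theorem component_add (d : ℕ) (F G : Rees ω) :
    component ω d (F + G) = component ω d F + component ω d G := by
  rw [component, component, component, ← mulT_add]
  exact mulT_congr ω _ _ rfl (coeff_add _ _ _)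

theorem component_mul (d : ℕ) (F G : Rees ω) :
    component ω d (F * G)
      = ∑ p ∈ Finset.HasAntidiagonal.antidiagonal d, component ω p.1 F * component ω p.2 G := by
  apply Subtype.ext
  rw [AddSubmonoidClass.coe_finsetSum]
  simp only [component, MulMemClass.coe_mul, coe_mulT, monomial_mul_monomial, coeff_mul, map_sum]
  refine Finset.sum_congr rfl fun p hp => ?_
  rw [Finset.HasAntidiagonal.mem_antidiagonal.1 hp]

theorem component_mulT (d e : ℕ) (f : A.Alg) (hf : f ∈ filt ω e) :
    component ω d (mulT ω e f hf) = if d = e then mulT ω e f hf else 0 := by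
  apply Subtype.ext
  split_ifs with h
  · subst h
    simp [component]
  · simp [component, coeff_monomial, Ne.symm h]

theorem dehomogenize_mulT (d : ℕ) (f : A.Alg) (hf : f ∈ filt ω d) :
    dehomogenize ω (mulT ω d f hf) = f := by
  simp [dehomogenize]

/-- Dehomogenization as a ring homomorphism. -/
def dehomogenizeHom : Rees ω →+* A.Alg :=
  -- Evaluation is multiplicative over noncommutative coefficients because the point 1 commutes with
  -- all of them.
  (eval₂RingHom' (RingHom.id A.Alg) 1 fun a => Commute.one_right a).comp
    (Rees ω).val.toRingHom

/-! ### The basis of standard monomials of the Rees algebra -/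

theorem list_ofFn_monomial_prod {R : Type*} [Semiring R] {k : ℕ} (a : Fin k → ℕ) (y : Fin k → R) :
    (List.ofFn fun i => monomial (a i) (y i)).prod = monomial (∑ i, a i) (List.ofFn y).prod := by
  induction k with
  | zero => simp
  | succ k ih => simp [List.ofFn_succ, Fin.sum_univ_succ, ih, monomial_mul_monomial]

theorem coe_reesMon (α : Expo n) (k : ℕ) :
    (reesMon ω (α, k) : A.Alg[X]) = monomial (wt ω.w α + k) (A.mon α) := by
  have h : ((stdMon (xTilde ω) α : Rees ω) : A.Alg[X]) = monomial (wt ω.w α) (A.mon α) := by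
    change (Rees ω).val _ = _
    rw [stdMon, map_list_prod, List.map_ofFn, wt, mon, stdMon, ← list_ofFn_monomial_prod]
    congr 2
    funext i
    simp [xTilde, monomial_pow]
  simp [reesMon, h, tVar, monomial_pow, monomial_mul_monomial]

/-- The coefficient of `x̃^α t^k`, read off from the coefficient of `t^(|α|_ω + k)`. -/
def reesCoeff (αk : Expo n × ℕ) : Rees ω →ₗ[K] K :=
  Finsupp.lapply αk.1 ∘ₗ (monBasis ω).repr.toLinearMap ∘ₗ
    ((lcoeff A.Alg (wtTilde ω αk)).restrictScalars K) ∘ₗ (Rees ω).val.toLinearMap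

theorem reesCoeff_apply (αk : Expo n × ℕ) (F : Rees ω) :
    reesCoeff ω αk F = (monBasis ω).repr ((F : A.Alg[X]).coeff (wtTilde ω αk)) αk.1 := rfl

/-- Given `α`, the power `|α|_ω + k` of `t` determines `k`; so the `t`-degree together with the
coefficient of `x^α` isolates one standard monomial. -/
theorem reesCoeff_linearCombination (αk : Expo n × ℕ) (p : Expo n × ℕ →₀ K) :
    reesCoeff ω αk (Finsupp.linearCombination K (reesMon ω) p) = p αk := by
  suffices h : reesCoeff ω αk ∘ₗ Finsupp.linearCombination K (reesMon ω) = Finsupp.lapply αk from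
    LinearMap.congr_fun h p
  refine Finsupp.lhom_ext' fun βl => LinearMap.ext_ring ?_
  obtain ⟨α, k⟩ := αk
  obtain ⟨β, l⟩ := βl
  have hβ : (monBasis ω).repr (A.mon β) = Finsupp.single β 1 := by
    rw [← coe_monBasis ω, Module.Basis.repr_self]
  simp only [LinearMap.comp_apply, Finsupp.lsingle_apply, Finsupp.linearCombination_single,
    one_smul, reesCoeff_apply, coe_reesMon, coeff_monomial, Finsupp.lapply_apply, wtTilde]
  by_cases hαβ : β = α
  · subst hαβ
    by_cases hkl : l = k
    · subst hkl
      simp [hβ]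
    · simp [hkl]
  · split_ifs <;> simp [hβ, hαβ]

theorem linearIndependent_reesMon : LinearIndependent K (reesMon ω) := by
  intro p q hpq
  ext αk
  rw [← reesCoeff_linearCombination ω αk p, hpq, reesCoeff_linearCombination]

theorem span_reesMon : Submodule.span K (Set.range (reesMon ω)) = ⊤ := by
  rw [eq_top_iff]
  rintro F -
  set S := Submodule.span K (Set.range (reesMon ω))
  have h : ∀ d, filt ω d ≤ (S.map (Rees ω).val.toLinearMap).comap
      ((monomial d : A.Alg →ₗ[A.Alg] A.Alg[X]).restrictScalars K) := by
    intro d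
    refine Submodule.span_le.2 ?_
    rintro _ ⟨α, hα, rfl⟩
    refine ⟨reesMon ω (α, d - wt ω.w α), Submodule.subset_span ⟨_, rfl⟩, ?_⟩
    change ((reesMon ω (α, d - wt ω.w α) : Rees ω) : A.Alg[X]) = monomial d (A.mon α)
    rw [coe_reesMon, Nat.add_sub_cancel' hα]
  have hF : (F : A.Alg[X]) ∈ S.map (Rees ω).val.toLinearMap := by
    rw [← (F : A.Alg[X]).sum_monomial_eq]
    exact Submodule.sum_mem _ fun d _ => h d (F.2 d)
  obtain ⟨G, hG, hGF⟩ := hF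
  rwa [← (Subtype.ext hGF : G = F)]

/-- The standard monomials as a basis of the Rees algebra. -/
def reesBasis : Module.Basis (Expo n × ℕ) K (Rees ω) :=
  Module.Basis.mk (linearIndependent_reesMon ω) (span_reesMon ω).ge

@[simp] theorem coe_reesBasis : ⇑(reesBasis ω) = reesMon ω := Module.Basis.coe_mk _ _

theorem mem_newton_rees_iff {F : Rees ω} {αk : Expo n × ℕ} :
    αk ∈ newton K (reesMon ω) F ↔
      αk.1 ∈ newton K A.mon ((F : A.Alg[X]).coeff (wtTilde ω αk)) := by
  rw [newton, ← coe_reesBasis ω, coeffs_eq_repr, Finsupp.mem_support_iff, mem_newton_iff ω,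
    ← reesCoeff_apply, ← reesCoeff_linearCombination ω αk, ← coe_reesBasis,
    Module.Basis.linearCombination_repr]

theorem mem_newton_mulT_iff {d : ℕ} {f : A.Alg} (hf : f ∈ filt ω d) {αk : Expo n × ℕ} :
    αk ∈ newton K (reesMon ω) (mulT ω d f hf) ↔
      wtTilde ω αk = d ∧ αk.1 ∈ newton K A.mon f := by
  rw [mem_newton_rees_iff, coe_mulT, coeff_monomial]
  split_ifs with h
  · simp [h]
  · simp [mem_newton_iff ω, Ne.symm h]

theorem wt_le_of_mem_newton {d : ℕ} {f : A.Alg} (hf : f ∈ filt ω d) {α : Expo n}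
    (hα : α ∈ newton K A.mon f) : wt ω.w α ≤ d :=
  wt_le_of_mem_filt ω hf ((mem_newton_iff ω).1 hα)

/-- If `(α, k)` is the leading exponent of `F`, then `α` is the leading exponent of the coefficient of `t^(|α|_ω + k)`. -/
theorem isLeadExp_coeff (m : MonomialOrder (Fin n)) {F : Rees ω} {αk : Expo n × ℕ}
    (h : IsLeadExp K (reesMon ω) (GtH ω m) F αk) :
    IsLeadExp K A.mon (Gt m) ((F : A.Alg[X]).coeff (wtTilde ω αk)) αk.1 := by
  refine ⟨(mem_newton_rees_iff ω).1 h.1, fun β hβ hne => ?_⟩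
  have hw := wt_le_of_mem_newton ω (F.2 _) hβ
  -- The exponent of `F` lying over `β` has the same weighted degree as `αk`, so only the second
  -- clause of `GtH` can apply.
  have he : wtTilde ω (β, wtTilde ω αk - wt ω.w β) = wtTilde ω αk := Nat.add_sub_cancel' hw
  have hmem : (β, wtTilde ω αk - wt ω.w β) ∈ newton K (reesMon ω) F := by
    rw [mem_newton_rees_iff, he]
    exact hβ
  rcases h.2 _ hmem fun e => hne (congrArg Prod.fst e) with hlt | ⟨-, hgt⟩
  · exact absurd hlt he.not_lt
  · exact hgt

theorem isLeadExp_mulT_iff (m : MonomialOrder (Fin n)) {d : ℕ} {f : A.Alg} (hf : f ∈ filt ω d)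
    {αk : Expo n × ℕ} :
    IsLeadExp K (reesMon ω) (GtH ω m) (mulT ω d f hf) αk ↔
      wtTilde ω αk = d ∧ IsLeadExp K A.mon (Gt m) f αk.1 := by
  constructor
  · intro h
    have hd := ((mem_newton_mulT_iff ω hf).1 h.1).1
    refine ⟨hd, ?_⟩
    have := isLeadExp_coeff ω m h
    rwa [coe_mulT, hd, coeff_monomial_same] at this
  · rintro ⟨hd, h⟩
    refine ⟨(mem_newton_mulT_iff ω hf).2 ⟨hd, h.1⟩, fun βl hβl hne => ?_⟩
    obtain ⟨hβd, hβ⟩ := (mem_newton_mulT_iff ω hf).1 hβl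
    refine Or.inr ⟨hd.trans hβd.symm, h.2 _ hβ fun e => hne (Prod.ext e ?_)⟩
    rw [← hd, wtTilde, wtTilde, e] at hβd
    exact Nat.add_left_cancel hβd

theorem isLeadExp_mulT (m : MonomialOrder (Fin n)) {d : ℕ} {f : A.Alg} (hf : f ∈ filt ω d)
    {α : Expo n} (h : IsLeadExp K A.mon (Gt m) f α) :
    IsLeadExp K (reesMon ω) (GtH ω m) (mulT ω d f hf) (α, d - wt ω.w α) :=
  (isLeadExp_mulT_iff ω m hf).2 ⟨Nat.add_sub_cancel' (wt_le_of_mem_newton ω hf h.1), h⟩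

theorem ne_zero_of_isLeadExp (ω : A.Weight) {gt : Expo n → Expo n → Prop} {f : A.Alg} {α : Expo n}
    (h : IsLeadExp K A.mon gt f α) : f ≠ 0 := by
  rintro rfl
  simpa using (mem_newton_iff ω).1 h.1

/-- A homogeneous element of the Rees algebra is of the form `f t^d`. -/
theorem IsHomog.exists_eq_mulT {F : Rees ω} (hF : IsHomog ω F) :
    ∃ (d : ℕ) (f : A.Alg) (hf : f ∈ filt ω d), F = mulT ω d f hf := by
  obtain ⟨d, hd⟩ := hF
  refine ⟨d, _, F.2 d, Subtype.ext (Polynomial.ext fun e => ?_)⟩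
  rw [coe_mulT, coeff_monomial]
  split_ifs with h
  · rw [h]
  -- An exponent `α` in the coefficient of `t^e` would give `F` an exponent of weighted degree `e ≠
  -- d`.
  · refine (monBasis ω).repr.map_eq_zero_iff.1 (Finsupp.ext fun α => ?_)
    by_contra hα
    have he : wtTilde ω (α, e - wt ω.w α) = e :=
      Nat.add_sub_cancel' (wt_le_of_mem_filt ω (F.2 e) hα)
    refine h ((hd (α, e - wt ω.w α) ?_).symm.trans he)
    rw [mem_newton_rees_iff, he]
    exact (mem_newton_iff ω).2 hα

/-! ### Ideals generated by homogenizations -/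

section Ideals

variable {ι : Type*} (f : ι → A.Alg)

/-- The generators are homogeneous, and a component of a product is a sum of products of components.
-/
theorem component_mem {F : Rees ω} (hF : F ∈ Ideal.span (Set.range fun k => homogenize ω (f k)))
    (d : ℕ) : component ω d F ∈ Ideal.span (Set.range fun k => homogenize ω (f k)) := by
  induction hF using Submodule.span_induction generalizing d with
  | mem x hx =>
    obtain ⟨k, rfl⟩ := hx
    simp only [homogenize, component_mulT]
    split_ifs
    · exact Ideal.subset_span ⟨k, rfl⟩
    · exact Ideal.zero_mem _
  | zero =>
    have : component ω d (0 : Rees ω) = 0 := (mulT_eq_zero_iff ω _).2 (coeff_zero d)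
    rw [this]
    exact Ideal.zero_mem _
  | add x y _ _ hx hy =>
    rw [component_add]
    exact add_mem (hx d) (hy d)
  | smul a x _ hx =>
    rw [smul_eq_mul, component_mul]
    exact sum_mem fun p _ => Ideal.mul_mem_left _ _ (hx p.2)

theorem dehomogenize_mem {F : Rees ω}
    (hF : F ∈ Ideal.span (Set.range fun k => homogenize ω (f k))) :
    dehomogenize ω F ∈ Ideal.span (Set.range f) := by
  have h : Ideal.span (Set.range fun k => homogenize ω (f k))
      ≤ (Ideal.span (Set.range f)).comap (dehomogenizeHom ω) := by
    refine Ideal.span_le.2 ?_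
    rintro _ ⟨k, rfl⟩
    change dehomogenize ω (homogenize ω (f k)) ∈ Ideal.span (Set.range f)
    rw [homogenize, dehomogenize_mulT]
    exact Ideal.subset_span ⟨k, rfl⟩
  exact h hF

/-- Every element of an ideal becomes an element of the ideal generated by the homogenized
generators after multiplication by any sufficiently high power of `t`. -/
theorem exists_mulT_mem {g : A.Alg} (hg : g ∈ Ideal.span (Set.range f)) :
    ∃ d₀ : ℕ, ∀ d, d₀ ≤ d → ∃ h : g ∈ filt ω d,
      mulT ω d g h ∈ Ideal.span (Set.range fun k => homogenize ω (f k)) := by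
  induction hg using Submodule.span_induction with
  | mem x hx =>
    obtain ⟨k, rfl⟩ := hx
    refine ⟨deg ω (f k), fun d hd => ⟨filt_mono ω hd (mem_filt_deg ω (f k)), ?_⟩⟩
    -- The element `1 · t^(d - deg)` of the Rees algebra raises the homogenized generator to degree
    -- `d`.
    have h1 : (1 : A.Alg) ∈ filt ω (d - deg ω (f k)) :=
      filt_mono ω (Nat.zero_le _) (one_mem_filt ω)
    have := Ideal.mul_mem_left _ (mulT ω _ 1 h1)
      (Ideal.subset_span ⟨k, rfl⟩ : homogenize ω (f k)
        ∈ Ideal.span (Set.range fun k => homogenize ω (f k)))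
    rw [homogenize, mulT_mul_mulT] at this
    rwa [mulT_congr ω _ _ (Nat.sub_add_cancel hd) (one_mul _)] at this
  | zero =>
    refine ⟨0, fun d _ => ⟨Submodule.zero_mem _, ?_⟩⟩
    rw [(mulT_eq_zero_iff ω _).2 rfl]
    exact Ideal.zero_mem _
  | add x y _ _ hx hy =>
    obtain ⟨d₁, h₁⟩ := hx
    obtain ⟨d₂, h₂⟩ := hy
    -- Two summands must be brought to the same power of `t`; this is why the claim covers all large
    -- `d`.
    refine ⟨max d₁ d₂, fun d hd => ?_⟩
    obtain ⟨hx, hxJ⟩ := h₁ d (le_trans (le_max_left _ _) hd)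
    obtain ⟨hy, hyJ⟩ := h₂ d (le_trans (le_max_right _ _) hd)
    exact ⟨add_mem hx hy, mulT_add ω hx hy ▸ add_mem hxJ hyJ⟩
  | smul a x _ hx =>
    obtain ⟨d₁, h₁⟩ := hx
    obtain ⟨e, he⟩ := exists_mem_filt ω a
    refine ⟨e + d₁, fun d hd => ?_⟩
    obtain ⟨d, rfl⟩ := Nat.exists_eq_add_of_le (le_trans (Nat.le_add_right _ _) hd)
    obtain ⟨hx, hxJ⟩ := h₁ d (by omega)
    refine ⟨mul_mem_filt ω he hx, ?_⟩
    have := Ideal.mul_mem_left _ (mulT ω e a he) hxJ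
    rwa [mulT_mul_mulT] at this

end Ideals

end GAlgebra
end GAlg
end

/-! ### The Gröbner basis of the dehomogenized ideal -/

open GAlg GAlg.GAlgebra in
theorem mainTheorem7 {K : Type*} [Field K] {n : ℕ} (A : GAlg.GAlgebra K n) (ω : A.Weight)
    (m : MonomialOrder (Fin n)) {r : ℕ} (f : Fin r → A.Alg)
    (I : Ideal A.Alg) (hI : I = Ideal.span (Set.range f)) (hI0 : I ≠ ⊥)
    (J : Ideal (GAlg.GAlgebra.Rees ω))
    (hJ : J = Ideal.span (Set.range fun k => GAlg.GAlgebra.homogenize ω (f k)))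
    (G : Set (GAlg.GAlgebra.Rees ω))
    (hG : GAlg.IsGroebnerBasis K (GAlg.GAlgebra.reesMon ω) (GAlg.GAlgebra.GtH ω m) J G)
    (hGhom : ∀ F ∈ G, GAlg.GAlgebra.IsHomog ω F) :
    GAlg.IsGroebnerBasis K A.mon (GAlg.GAlgebra.Gt m) I
      (GAlg.GAlgebra.dehomogenize ω '' G) := by
  obtain ⟨hfin, hsub, hexp⟩ := hG
  subst hI hJ
  refine ⟨hfin.image _, ?_, Set.Subset.antisymm ?_ ?_⟩
  · rintro _ ⟨F, hF, rfl⟩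
    refine ⟨dehomogenize_mem ω f (hsub hF).1, fun h0 => (hsub hF).2 ?_⟩
    obtain ⟨d, g, hg, rfl⟩ := (hGhom F hF).exists_eq_mulT
    rw [Set.mem_singleton_iff, dehomogenize_mulT] at h0
    exact (mulT_eq_zero_iff ω hg).2 h0
  · rintro α ⟨g, hgI, hg0, hα⟩
    obtain ⟨d, hd⟩ := exists_mulT_mem ω f hgI
    obtain ⟨hg, hgJ⟩ := hd d le_rfl
    have hmem : (α, d - wt ω.w α) ∈ expSet K (reesMon ω) (GtH ω m)
        (Ideal.span (Set.range fun k => homogenize ω (f k)) : Set (Rees ω)) :=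
      ⟨_, hgJ, fun h => hg0 ((mulT_eq_zero_iff ω hg).1 h), isLeadExp_mulT ω m hg hα⟩
    rw [hexp] at hmem
    obtain ⟨F, hF, γ, β, hγ, hsum⟩ := hmem
    refine ⟨_, ⟨F, hF, rfl⟩, γ.1, β.1, ?_, congrArg Prod.fst hsum⟩
    obtain ⟨e, g', hg', rfl⟩ := (hGhom F hF).exists_eq_mulT
    rw [dehomogenize_mulT]
    exact ((isLeadExp_mulT_iff ω m hg').1 hγ).2
  · rintro _ ⟨_, ⟨F, hF, rfl⟩, γ, β, hγ, rfl⟩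
    obtain ⟨d, g, hg, rfl⟩ := (hGhom F hF).exists_eq_mulT
    rw [dehomogenize_mulT] at hγ
    -- The hypothesis on `G` itself provides an element of `J` with leading exponent `(γ + β, d -
    -- |γ|_ω)`, so leading exponents of products are not needed. It may be inhomogeneous; its
    -- component in the leading degree stays in `J` and dehomogenizes to an element of `I` with
    -- leading exponent `γ + β`.
    obtain ⟨F', hF', -, hlead⟩ := hexp.ge
      ⟨_, hF, _, (β, 0), isLeadExp_mulT ω m hg hγ, rfl⟩
    have hcoeff := isLeadExp_coeff ω m hlead
    refine ⟨_, ?_, ne_zero_of_isLeadExp ω hcoeff, hcoeff⟩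
    have := dehomogenize_mem ω f (component_mem ω f hF' (wtTilde ω ((γ, d - wt ω.w γ) + (β, 0))))
    rwa [component, dehomogenize_mulT] at this
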